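/- **Setting.** Let $f:\mathbb R^d\times\mathbb R^m\times\mathbb R^q\to\mathbb R^d$ be continuous with $f(0,0,0)=0$, let $\mathbb M\subset\mathbb R^d$ be closed and $\mathbb U\subset\mathbb R^m$, $\mathbb W\subset\mathbb R^q$, $\mathcal M_F\subset\mathbb R^d$ be compact, each containing the origin in its interior, let $N\ge 1$, and let $c:\mathbb R^d\times\mathbb R^m\to[0,\infty)$, $c_F:\mathbb R^d\to[0,\infty)$ satisfy $c(0,0)=0$, $c_F(0)=0$. Fix $\varepsilon>0$ and a norm $\|\cdot\|_p$, $p\in[1,\infty]$, on $\mathbb R^m$; put $\mathbb V=\{v:\|v\|_p\le\varepsilon\}$ and $\bar f(x,u,(w,v))=f(x,u+v,w)$. Consider the min-max problem with parameter $\bar x$ $$\inf_{\pi}\ \sup_{(w_t,v_t)\in\mathbb W\times\mathbb V}\ \sum_{t=0}^{N-1}c(x_t,u_t)+c_F(x_N),\qquad x_{t+1}=\bar f(x_t,u_t,(w_t,v_t)),\ x_0=\bar x,\ u_t=\pi_t(x_t),$$ over measurable $\pi_0,\dots,\pi_{N-1}:\mathbb M\to\mathbb U$ such that $x_t\in\mathbb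 M$, $u_t+v_t\in\mathbb U$ $(0\le t<N)$ and $x_N\in\mathcal M_F$ for all noises in $\mathbb W\times\mathbb V$. Let $X_N$ be the set of all $\bar x$ for which a feasible $\pi$ exists. **Assumptions.** $X_N\neq\emptyset$, and for each $\bar x\in X_N$ the problem has a solution, any two solutions prescribing the same first action $\mu_0^*(\bar x)$; $\mu_0^*$ is Lipschitz on $X_N$ with constant $L_0$. Moreover: * there are $b>0$ and a measurable $\mu_F:\mathcal M_F\to\mathbb U$ such that for all $\xi\in\mathcal M_F$, $(w,v)\in\mathbb W\times\mathbb V$: $\mu_F(\xi)+v\in\mathbb U$, $\bar f(\xi,\mu_F(\xi),(w,v))\in\mathcal M_F$ and $c_F(\bar f(\xi,\mu_F(\xi),(w,v)))-c_F(\xi)\le -c(\xi,\mu_F(\xi))+b$; * $\mathcal M_F\subset\mathbb M$, and there are class-$\mathcal K_\infty$ functions $\alpha_1,\alpha_2$ with $c(\xi,u)\ge\alpha_1(|\xi|)$ for $\xi\in X_N$, $u\in\mathbb U$, and $c_F(\xi)\le\alpha_2(|\xi|)$ for $\xi\in\mathcal M_F$. **Approximate feedback.** For a Schwartz function $\psi$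 on $\mathbb R^d$ and $h,\mathcal D,\rho>0$ put, componentwise, $\mu_E^*(x)=\inf_{y\in X_N\cap h\mathbb Z^d}\bigl(\mu_0^*(y)+L_0\|x-y\|_2\bigr)$ and $$\mu_0^\dagger(x)=\mathcal D^{-d/2}\sum_{k\in\mathbb Z^d,\ \|x-kh\|_2\le\rho h}\mu_E^*(kh)\,\psi\Bigl(\frac{x-kh}{h\sqrt{\mathcal D}}\Bigr).$$ Suppose $(\psi,h,\mathcal D,\rho)$ is chosen so that the prescribed error margin is met: $\|\mu_0^*(x)-\mu_0^\dagger(x)\|_p\le\varepsilon$ for all $x\in X_N$. **Conclusion.** For the closed loop $x_{t+1}=f(x_t,\mu_0^\dagger(x_t),w_t)$, $w_t\in\mathbb W$: 1. (Recursive feasibility.) If $x_0\in X_N$ then $x_t\in X_N$, $x_t\in\mathbb M$ and $\mu_0^\dagger(x_t)\in\mathbb U$ for all $t\ge 0$; in particular $X_N$ is robustly positively invariant. 2. If $X_N$ is compact, the closed loop is regionally practically input-to-state stable in $X_N$: $X_N$ is compact and robustly positively invariant, and there are $\beta\in\mathcal{KL}$, $\lambda\in\mathcal K$ and $\varphi>0$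 such that for all $x_0\in X_N$, all disturbance sequences $w$ in $\mathbb W$ and all $t\ge 0$ $$|x_t|\le\max\Bigl\{\beta(|x_0|,t),\ \lambda\bigl(\sup_{0\le k\le t}|w_k|\bigr)\Bigr\}+\varphi .\qquad(*)$$ 3. If $X_N$ is not assumed compact but $c$ is bounded on $\{(x,u)\in\mathbb M\times\mathbb U:|x|\le r\}$ for every $r\ge 0$ (for instance if $c$ is continuous), there are still such $\beta,\lambda,\varphi$ with $(*)$ for all $x_0\in X_N$, $w$ and $t$. -/

import Mathlib

open Filter Topology
open scoped NNReal ENNReal SchwartzMap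

/-- `ℝⁿ` with the Euclidean norm. -/
abbrev Vec (n : ℕ) : Type := EuclideanSpace ℝ (Fin n)

/-! ### Comparison functions and stability notions -/

/-- Class `𝒦`: continuous, strictly increasing, zero at zero. -/
def IsClassK (α : ℝ≥0 → ℝ≥0) : Prop :=
  Continuous α ∧ StrictMono α ∧ α 0 = 0

/-- Class `𝒦_∞`: class `𝒦` and unbounded. -/
def IsClassKInf (α : ℝ≥0 → ℝ≥0) : Prop :=
  IsClassK α ∧ Tendsto α atTop atTop

/-- Class `𝒦ℒ`: continuous, class `𝒦` in the first argument, strictly decreasing to `0` in the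
second argument (for every positive value of the first one). -/
def IsClassKL (β : ℝ≥0 → ℝ≥0 → ℝ≥0) : Prop :=
  Continuous (Function.uncurry β) ∧ (∀ t, IsClassK fun s => β s t) ∧
    ∀ s, 0 < s → StrictAnti (β s) ∧ Tendsto (β s) atTop (𝓝 0)

/-- The state trajectory `x(t; x₀, w)` of `x_{t+1} = g(x_t, w_t)`. -/
def trajectory {d q : ℕ} (g : Vec d → Vec q → Vec d) (x₀ : Vec d) (w : ℕ → Vec q) : ℕ → Vec d
  | 0 => x₀
  | t + 1 => g (trajectory g x₀ w t) (w t)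

/-- `X` is robustly positively invariant for `x_{t+1} = g(x_t, w_t)` with disturbances in `W`. -/
def IsRPI {d q : ℕ} (g : Vec d → Vec q → Vec d) (W : Set (Vec q)) (X : Set (Vec d)) : Prop :=
  ∀ x ∈ X, ∀ w ∈ W, g x w ∈ X

/-- The practical ISS estimate, uniformly over initial states in `X` and disturbance sequences
in `W`: `|x(t; x₀, w)| ≤ max {β(|x₀|, t), λ(sup_{0 ≤ k ≤ t} |w_k|)} + φ`. -/
def PracticalISSEstimate {d q : ℕ} (g : Vec d → Vec q → Vec d) (W : Set (Vec q))
    (X : Set (Vec d)) : Prop :=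
  ∃ (β : ℝ≥0 → ℝ≥0 → ℝ≥0) (lam : ℝ≥0 → ℝ≥0) (φ : ℝ≥0),
    IsClassKL β ∧ IsClassK lam ∧ 0 < φ ∧
      ∀ x₀ ∈ X, ∀ w : ℕ → Vec q, (∀ k, w k ∈ W) → ∀ t : ℕ,
        ‖trajectory g x₀ w t‖₊ ≤
          max (β ‖x₀‖₊ (t : ℝ≥0)) (lam ((Finset.range (t + 1)).sup fun k => ‖w k‖₊)) + φ

/-- Regional (practical) input-to-state stability in the compact set `X`. -/
def IsRegionalPracticalISS {d q : ℕ} (g : Vec d → Vec q → Vec d) (W : Set (Vec q))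
    (X : Set (Vec d)) : Prop :=
  IsCompact X ∧ IsRPI g W X ∧ PracticalISSEstimate g W X

/-! ### The robust optimal control problem -/

/-- The data of the constrained system `x_{t+1} = f(x_t, u_t, w_t)`, of the robust optimal control
problem, and the designer's error margin `ε` (measured in the `p`-norm of the control space). -/
structure MPCData (d m q : ℕ) where
  /-- the dynamics -/
  f : Vec d → Vec m → Vec q → Vec d
  f_cont : Continuous fun z : Vec d × Vec m × Vec q => f z.1 z.2.1 z.2.2
  f_zero : f 0 0 0 = 0
  /-- the state constraint set -/
  stateSet : Set (Vec d)
  stateSet_closed : IsClosed stateSet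
  zero_mem_interior_stateSet : 0 ∈ interior stateSet
  /-- the control constraint set -/
  ctrlSet : Set (Vec m)
  ctrlSet_compact : IsCompact ctrlSet
  zero_mem_interior_ctrlSet : 0 ∈ interior ctrlSet
  /-- the disturbance set -/
  distSet : Set (Vec q)
  distSet_compact : IsCompact distSet
  zero_mem_interior_distSet : 0 ∈ interior distSet
  /-- the horizon -/
  N : ℕ
  one_le_N : 1 ≤ N
  /-- the cost per stage -/
  cost : Vec d → Vec m → ℝ≥0
  cost_zero : cost 0 0 = 0
  /-- the final-stage cost -/
  finalCost : Vec d → ℝ≥0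
  finalCost_zero : finalCost 0 = 0
  /-- the terminal set -/
  terminalSet : Set (Vec d)
  terminalSet_compact : IsCompact terminalSet
  zero_mem_interior_terminalSet : 0 ∈ interior terminalSet
  /-- the exponent of the norm in which control errors are measured -/
  p : ℝ≥0∞
  one_le_p : 1 ≤ p
  /-- the error margin -/
  ε : ℝ
  ε_pos : 0 < ε

namespace MPCData

variable {d m q : ℕ} (P : MPCData d m q)

/-- The `p`-norm on the control space. -/
noncomputable def ctrlNorm (v : Vec m) : ℝ :=
  ‖(WithLp.toLp P.p (WithLp.ofLp v) : PiLp P.p fun _ : Fin m => ℝ)‖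

/-- The set `𝕍` of control noises: the closed `p`-norm ball of radius `ε` around `0`. -/
def ctrlNoise : Set (Vec m) := {v | P.ctrlNorm v ≤ P.ε}

/-- The noisy dynamics `f̄(x, u, (w, v)) = f(x, u + v, w)`. -/
def fbar (x : Vec d) (u : Vec m) (w : Vec q) (v : Vec m) : Vec d := P.f x (u + v) w

/-- The predicted states `x_{t+1} = f̄(x_t, π_t(x_t), (w_t, v_t))`. -/
def predicted (π : ℕ → Vec d → Vec m) (x₀ : Vec d) (w : ℕ → Vec q) (v : ℕ → Vec m) : ℕ → Vec d
  | 0 => x₀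
  | t + 1 => P.fbar (predicted π x₀ w v t) (π t (predicted π x₀ w v t)) (w t) (v t)

/-- Admissible noise sequences (only the first `N` entries matter below). -/
def IsNoise (w : ℕ → Vec q) (v : ℕ → Vec m) : Prop :=
  ∀ t, w t ∈ P.distSet ∧ v t ∈ P.ctrlNoise

/-- Admissible policies: `π_0, …, π_{N-1}` are measurable maps from the state constraint set to the
control constraint set. -/
def IsPolicy (π : ℕ → Vec d → Vec m) : Prop :=
  ∀ t < P.N, (Measurable fun x : P.stateSet => π t x) ∧ ∀ x ∈ P.stateSet, π t x ∈ P.ctrlSet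

/-- The policy `π` satisfies all constraints of the approximation-ready problem at `x₀`, whatever
the noise. -/
def IsFeasible (x₀ : Vec d) (π : ℕ → Vec d → Vec m) : Prop :=
  P.IsPolicy π ∧ ∀ w v, P.IsNoise w v →
    (∀ t < P.N, P.predicted π x₀ w v t ∈ P.stateSet ∧
      π t (P.predicted π x₀ w v t) + v t ∈ P.ctrlSet) ∧
    P.predicted π x₀ w v P.N ∈ P.terminalSet

/-- The total cost along one noise realization. -/
noncomputable def totalCost (x₀ : Vec d) (π : ℕ → Vec d → Vec m) (w : ℕ → Vec q)
    (v : ℕ → Vec m) : ℝ≥0 :=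
  (∑ t ∈ Finset.range P.N,
    P.cost (P.predicted π x₀ w v t) (π t (P.predicted π x₀ w v t))) +
      P.finalCost (P.predicted π x₀ w v P.N)

/-- The worst-case cost: the supremum over all noises, in `[0, ∞]`. -/
noncomputable def worstCost (x₀ : Vec d) (π : ℕ → Vec d → Vec m) : ℝ≥0∞ :=
  ⨆ (w : ℕ → Vec q) (v : ℕ → Vec m) (_ : P.IsNoise w v), (P.totalCost x₀ π w v : ℝ≥0∞)

/-- `π` solves the approximation-ready min-max problem with initial state `x₀`. -/
def IsSolution (x₀ : Vec d) (π : ℕ → Vec d → Vec m) : Prop :=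
  P.IsFeasible x₀ π ∧ ∀ π', P.IsFeasible x₀ π' → P.worstCost x₀ π ≤ P.worstCost x₀ π'

/-- The set `X_N` of feasible initial states. -/
def feasibleSet : Set (Vec d) := {x | ∃ π, P.IsFeasible x π}

/-- `X_N` is nonempty and the problem has a solution for every initial state in `X_N`, unique in
what it prescribes at the initial state. (A policy is a map on the whole state constraint set, and
its values at states that are not visited never enter the problem.) -/
def HasUniqueSolutions : Prop :=
  P.feasibleSet.Nonempty ∧ ∀ x ∈ P.feasibleSet,
    (∃ π, P.IsSolution x π) ∧ ∀ π π', P.IsSolution x π → P.IsSolution x π' → π 0 x = π' 0 x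

open Classical in
/-- The receding horizon feedback `μ₀*`: the first entry of the solution for the initial state `x`,
evaluated at `x` (and `0` where there is no solution). -/
noncomputable def optFeedback (x : Vec d) : Vec m :=
  if h : ∃ π, P.IsSolution x π then h.choose 0 x else 0

/-- The conditions on terminal set, terminal cost and stage cost. -/
def StabilityAssumption : Prop :=
  (∃ (μF : Vec d → Vec m) (b : ℝ), 0 < b ∧
    (Measurable fun x : P.terminalSet => μF x) ∧
    ∀ x ∈ P.terminalSet, ∀ w ∈ P.distSet, ∀ v ∈ P.ctrlNoise,
      μF x + v ∈ P.ctrlSet ∧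
      P.fbar x (μF x) w v ∈ P.terminalSet ∧
      (P.finalCost (P.fbar x (μF x) w v) : ℝ) - P.finalCost x ≤ -(P.cost x (μF x) : ℝ) + b) ∧
  P.terminalSet ⊆ P.stateSet ∧
  ∃ α₁ α₂ : ℝ≥0 → ℝ≥0, IsClassKInf α₁ ∧ IsClassKInf α₂ ∧
    (∀ x ∈ P.feasibleSet, ∀ u ∈ P.ctrlSet, α₁ ‖x‖₊ ≤ P.cost x u) ∧
    ∀ x ∈ P.terminalSet, P.finalCost x ≤ α₂ ‖x‖₊

/-- The stage cost is bounded on bounded sets of states (e.g. because it is continuous). -/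
def CostBoundedOnBounded : Prop :=
  ∀ r : ℝ≥0, ∃ C : ℝ≥0, ∀ x ∈ P.stateSet, ‖x‖₊ ≤ r → ∀ u ∈ P.ctrlSet, P.cost x u ≤ C

/-! ### The approximate feedback -/

/-- The point `m h` of the uniform cardinal grid. -/
noncomputable def gridPoint (h : ℝ) (k : Fin d → ℤ) : Vec d :=
  WithLp.toLp 2 fun i => (k i : ℝ) * h

/-- The part of the grid in `X_N`. -/
def gridNet (h : ℝ) : Set (Vec d) := P.feasibleSet ∩ Set.range (gridPoint h)

/-- The extension of `μ₀*` from the grid points in `X_N` to `ℝᵈ`, component by component: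
`x ↦ inf_y (μ₀*(y) + L₀ ‖x - y‖)`. -/
noncomputable def extFeedback (L₀ : ℝ≥0) (h : ℝ) (x : Vec d) : Vec m :=
  WithLp.toLp 2 fun i => ⨅ y : P.gridNet h, (P.optFeedback y i + L₀ * ‖x - y‖)

/-- The truncated quasi-interpolant `μ₀†` of the extended feedback. The sum is over the grid points
in the closed Euclidean ball of radius `ρ h` around `x`, which are finitely many. -/
noncomputable def approxFeedback (L₀ : ℝ≥0) (ψ : 𝓢(Vec d, ℝ)) (h D ρ : ℝ) (x : Vec d) : Vec m :=
  D ^ (-(d : ℝ) / 2) •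
    ∑ᶠ k ∈ {k : Fin d → ℤ | ‖x - gridPoint h k‖ ≤ ρ * h},
      ψ ((h * √D)⁻¹ • (x - gridPoint h k)) • P.extFeedback L₀ h (gridPoint h k)

/-- The original system in closed loop with the feedback `μ`. -/
def closedLoop (μ : Vec d → Vec m) (x : Vec d) (w : Vec q) : Vec d := P.f x (μ x) w

/-- Recursive feasibility under the feedback `μ`: along every closed-loop trajectory that starts at
a feasible state, the problem stays feasible and the state and control constraints hold. -/
def RecursivelyFeasible (μ : Vec d → Vec m) : Prop :=
  ∀ x₀ ∈ P.feasibleSet, ∀ w : ℕ → Vec q, (∀ k, w k ∈ P.distSet) → ∀ t,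
    trajectory (P.closedLoop μ) x₀ w t ∈ P.feasibleSet ∧
    trajectory (P.closedLoop μ) x₀ w t ∈ P.stateSet ∧
    μ (trajectory (P.closedLoop μ) x₀ w t) ∈ P.ctrlSet

end MPCData

/-!
The approximate feedback differs from the receding horizon feedback `μ₀*` by a vector of `p`-norm
at most `ε`, so applying it is the same as applying `μ₀*` together with one particular admissible
control noise. Everything then follows from the robustness that is built into the min-max problem.

*Recursive feasibility.* If `π` is feasible at `x` and `x⁺ = f̄(x, π₀(x), (w, v))`, then the policy
`π₁, …, π_{N-1}, μ_F` is feasible at `x⁺`: its trajectories continue those of `π` from `x`, which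
reach the terminal set after `N` steps, and `μ_F` keeps them there
(`MPCData.IsFeasible.shiftPolicy`).

*Decrease of the value function.* Comparing costs along the same trajectories and using the terminal
inequality, the optimal value `V` satisfies `V(x⁺) + c(x, μ₀*(x)) ≤ V(x) + b`
(`MPCData.valueFn_closedLoop_add_cost_le`). As a stage cost is always paid at the initial state,
`α₁(|x|) ≤ V(x)`; if the stage cost is bounded on bounded sets, then so is `V`, because `N` steps of
a continuous system with controls and disturbances in compact sets reach only a bounded set
(`MPCData.exists_worstCost_le`).

*From decrease to stability.* Where `α₁(|x|) ≥ b + 1` the value drops by at least `1` per step, and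
elsewhere it is bounded, so `V(x_t) ≤ max (V(x₀) - t) M`. If `κ` is of class `𝒦` and dominates the
bound on `V` up to a constant, then up to constants this is at most
`2 κ (1 + κ) / (1 + κ + t)` with `κ = κ(|x₀|)`, and composing with `α₁⁻¹` gives a `𝒦ℒ` bound
(`exists_classKL_bound_of_decrease`). The disturbances only enter through the compactness of their
set, so their contribution is part of the offset `φ`, and the gain `λ` can be any function of
class `𝒦`.

When the feasible set is compact and nothing is assumed on the stage cost, the optimal value may be
infinite. The estimate then comes from invariance alone, with the radius of the feasible set
as offset.
-/

/-! ### Comparison functions -/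

theorem isClassK_id : IsClassK id := ⟨continuous_id, strictMono_id, rfl⟩

/-- A continuous function of class `𝒦` dominates a given monotone function up to a constant. -/
theorem exists_isClassK_le_add {g : ℝ≥0 → ℝ≥0} (hg : Monotone g) :
    ∃ (κ : ℝ≥0 → ℝ≥0) (C : ℝ≥0), IsClassK κ ∧ ∀ s, g s ≤ κ s + C := by
  let G : ℝ → ℝ := fun τ => g (τ + 1).toNNReal
  have hG : Monotone G := fun a b hab =>
    NNReal.coe_le_coe.2 (hg (Real.toNNReal_le_toNNReal (by linarith)))
  have hG0 : ∀ τ, 0 ≤ G τ := fun τ => NNReal.coe_nonneg _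
  have hint : ∀ a b, IntervalIntegrable G MeasureTheory.volume a b := fun a b =>
    hG.intervalIntegrable
  have hcont : Continuous fun s : ℝ => ∫ τ in (0 : ℝ)..s, G τ :=
    intervalIntegral.continuous_primitive hint 0
  have hnn : ∀ a b : ℝ, a ≤ b → 0 ≤ ∫ τ in a..b, G τ := fun a b hab =>
    intervalIntegral.integral_nonneg hab fun τ _ => hG0 τ
  have hadd : ∀ a b : ℝ, (∫ τ in (0 : ℝ)..a, G τ) + ∫ τ in a..b, G τ = ∫ τ in (0 : ℝ)..b, G τ :=
    fun a b => intervalIntegral.integral_add_adjacent_intervals (hint _ _) (hint _ _)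
  refine ⟨fun s => s + (∫ τ in (0 : ℝ)..s, G τ).toNNReal, g 1, ⟨?_, ?_, ?_⟩, fun s => ?_⟩
  · exact continuous_id.add
      (continuous_real_toNNReal.comp (hcont.comp NNReal.continuous_coe))
  · refine strictMono_id.add_monotone fun a b hab => Real.toNNReal_le_toNNReal ?_
    have h1 := hadd a b
    have h2 := hnn a b (NNReal.coe_le_coe.2 hab)
    linarith
  · simp
  · rcases le_total s 1 with hs | hs
    · exact (hg hs).trans le_add_self
    · refine le_add_right (le_add_left ?_)
      have hs' : (1 : ℝ) ≤ s := by exact_mod_cast hs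
      refine NNReal.le_toNNReal_of_coe_le ?_
      -- on `[s - 1, s]` the integrand is at least `g s`
      have h1 : (g s : ℝ) ≤ ∫ τ in ((s : ℝ) - 1)..s, G τ := by
        have h2 : ∫ _ in ((s : ℝ) - 1)..s, (g s : ℝ) ≤ ∫ τ in ((s : ℝ) - 1)..s, G τ := by
          refine intervalIntegral.integral_mono_on (by linarith) (by simp) (hint _ _)
            fun τ hτ => NNReal.coe_le_coe.2 (hg ?_)
          exact NNReal.le_toNNReal_of_coe_le (by linarith [hτ.1])
        simpa using h2
      have h3 := hadd ((s : ℝ) - 1) s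
      have h4 := hnn 0 ((s : ℝ) - 1) (by linarith)
      linarith

/-- The `𝒦ℒ` function behind all estimates. The function `κ (1 + κ) / (1 + κ + t)`, with `κ = κ s`,
dominates `κ s - t` (`sub_le_decay`); `e` is an increasing bijection, such as the inverse of a
`𝒦_∞` function. -/
theorem isClassKL_decay {κ : ℝ≥0 → ℝ≥0} (hκ : IsClassK κ) (e : ℝ≥0 ≃o ℝ≥0) :
    IsClassKL fun s t => e (2 * (κ s * (1 + κ s) / (1 + κ s + t))) := by
  obtain ⟨hc, hm, h0⟩ := hκ
  have he0 : e 0 = 0 := e.map_bot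
  refine ⟨?_, fun t => ⟨?_, ?_, ?_⟩, fun s hs => ⟨?_, ?_⟩⟩
  · refine e.continuous.comp (continuous_const.mul (Continuous.div₀ ?_ ?_ fun z => ?_))
    · fun_prop
    · fun_prop
    · positivity
  · refine e.continuous.comp (continuous_const.mul (Continuous.div₀ ?_ ?_ fun z => ?_))
    · fun_prop
    · fun_prop
    · positivity
  · intro a b hab
    refine e.strictMono (mul_lt_mul_of_pos_left ?_ two_pos)
    have h1 : (κ a : ℝ) < κ b := by exact_mod_cast hm hab
    have ha : (0 : ℝ) ≤ κ a := NNReal.coe_nonneg _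
    have ht : (0 : ℝ) ≤ t := NNReal.coe_nonneg _
    rw [← NNReal.coe_lt_coe]
    push_cast
    rw [div_lt_div_iff₀ (by positivity) (by positivity)]
    -- the difference of the two sides is `(y - x) ((1 + x) (1 + y) + t (1 + x + y))`
    have hb : (0 : ℝ) ≤ κ b := NNReal.coe_nonneg _
    generalize (κ a : ℝ) = x at *
    generalize (κ b : ℝ) = y at *
    have h2 : 0 < (y - x) * ((1 + x) * (1 + y) + t * (1 + x + y)) :=
      mul_pos (sub_pos.2 h1) (by positivity)
    linear_combination h2
  · simp [h0, he0]
  · intro a b hab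
    refine e.strictMono (mul_lt_mul_of_pos_left ?_ two_pos)
    have hpos : 0 < κ s := by simpa [h0] using hm hs
    exact div_lt_div_of_pos_left (by positivity) (by positivity) (by gcongr)
  · rw [← he0]
    refine (e.continuous.tendsto 0).comp ?_
    have h1 : Tendsto (fun t : ℝ≥0 => (1 : ℝ) + κ s + t) atTop atTop :=
      tendsto_atTop_add_const_left _ _ (NNReal.tendsto_coe_atTop.2 tendsto_id)
    have h2 := (h1.const_div_atTop ((κ s : ℝ) * (1 + κ s))).const_mul 2
    rw [← NNReal.tendsto_coe]
    simpa using h2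

theorem sub_le_decay (k t : ℝ≥0) : k - t ≤ k * (1 + k) / (1 + k + t) := by
  rw [tsub_le_iff_right, ← NNReal.coe_le_coe]
  push_cast
  have hk : (0 : ℝ) ≤ k := NNReal.coe_nonneg _
  have ht : (0 : ℝ) ≤ t := NNReal.coe_nonneg _
  have : (k : ℝ) - t ≤ k * (1 + k) / (1 + k + t) := by
    rw [le_div_iff₀ (by positivity)]
    nlinarith
  linarith

/-- A nonnegative quantity `V` that drops by at least `α (y t) - b` in each step, and is bounded in
terms of `y`, decreases at unit speed until it is below a constant: it drops by `1` where `α` is at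
least `b + 1`, and elsewhere `y` is bounded. -/
theorem le_max_sub_of_decrease {α γ : ℝ≥0 → ℝ≥0} (hα : StrictMono α) (hγ : Monotone γ)
    {b r : ℝ≥0} (hr : α r = b + 1) {V y : ℕ → ℝ≥0} (hVγ : ∀ t, V t ≤ γ (y t))
    (hV : ∀ t, V (t + 1) + α (y t) ≤ V t + b) (t : ℕ) :
    V t ≤ max (V 0 - t) (γ r + b) := by
  induction t with
  | zero => simp
  | succ t ih =>
    rcases le_total (y t) r with h | h
    · refine le_max_of_le_right ?_
      calc V (t + 1) ≤ V (t + 1) + α (y t) := le_self_add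
        _ ≤ V t + b := hV t
        _ ≤ γ r + b := by gcongr; exact (hVγ t).trans (hγ h)
    · have h1 : V (t + 1) + 1 ≤ V t := by
        have h2 := hα.monotone h
        have h3 := (add_le_add_right h2 (V (t + 1))).trans (hV t)
        rw [hr, add_comm b, ← add_assoc] at h3
        exact le_of_add_le_add_right h3
      rcases le_max_iff.1 ih with h2 | h2
      · refine le_max_of_le_left ?_
        push_cast
        rw [← tsub_tsub]
        exact le_tsub_of_add_le_right (h1.trans h2)
      · exact le_max_of_le_right (le_self_add.trans (h1.trans h2))

/-- A `𝒦ℒ` estimate with offset, uniform in all sequences along which a Lyapunov-like quantity `V`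
drops by at least `α (y t) - b` in each step. The upper bound `γ` on `V` need not vanish at `0`. -/
theorem exists_classKL_bound_of_decrease {α γ : ℝ≥0 → ℝ≥0} (hα : IsClassKInf α)
    (hγ : Monotone γ) (b : ℝ≥0) :
    ∃ (β : ℝ≥0 → ℝ≥0 → ℝ≥0) (φ : ℝ≥0), IsClassKL β ∧ 0 < φ ∧
      ∀ V y : ℕ → ℝ≥0, (∀ t, α (y t) ≤ V t) → (∀ t, V t ≤ γ (y t)) →
        (∀ t, V (t + 1) + α (y t) ≤ V t + b) → ∀ t : ℕ, y t ≤ β (y 0) t + φ := by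
  obtain ⟨⟨hc, hm, h0⟩, hlim⟩ := hα
  have hsurj : Function.Surjective α := by
    refine hc.surjective hlim ?_
    rw [OrderBot.atBot_eq, tendsto_pure]
    exact h0
  let e : ℝ≥0 ≃o ℝ≥0 := (hm.orderIsoOfSurjective α hsurj).symm
  have he : ∀ z, e (α z) = z := fun z => (hm.orderIsoOfSurjective α hsurj).symm_apply_apply z
  obtain ⟨κ, C, hκ, hκC⟩ := exists_isClassK_le_add hγ
  obtain ⟨r, hr⟩ := hsurj (b + 1)
  let E : ℝ≥0 := max (2 * C) (γ r + b)
  refine ⟨_, e E + 1, isClassKL_decay hκ e, by positivity, fun V y hαV hVγ hV t => ?_⟩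
  set z : ℝ≥0 := 2 * (κ (y 0) * (1 + κ (y 0)) / (1 + κ (y 0) + t)) with hz
  have hle : α (y t) ≤ max z E := by
    refine (hαV t).trans ((le_max_sub_of_decrease hm hγ hr hVγ hV t).trans
      (max_le ?_ ((le_max_right _ _).trans (le_max_right _ _))))
    have h1 : V 0 - t ≤ (κ (y 0) - t) + C := by
      rw [tsub_le_iff_right]
      calc V 0 ≤ κ (y 0) + C := (hVγ 0).trans (hκC _)
        _ ≤ (κ (y 0) - t + t) + C := by gcongr; exact le_tsub_add
        _ = κ (y 0) - t + C + t := by ring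
    have h2 := sub_le_decay (κ (y 0)) t
    rcases le_total (κ (y 0) - t) C with h3 | h3
    · refine le_max_of_le_right (le_max_of_le_left ?_)
      rw [two_mul]
      exact h1.trans (add_le_add_left h3 C)
    · refine le_max_of_le_left ?_
      rw [hz]
      calc V 0 - t ≤ (κ (y 0) - t) + (κ (y 0) - t) := h1.trans (by gcongr)
        _ = 2 * (κ (y 0) - t) := (two_mul _).symm
        _ ≤ _ := by gcongr
  calc y t = e (α (y t)) := (he _).symm
    _ ≤ e (max z E) := e.monotone hle
    _ = max (e z) (e E) := e.monotone.map_max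
    _ ≤ e z + e E := max_le le_self_add le_add_self
    _ ≤ e z + (e E + 1) := by gcongr; exact le_self_add

/-! ### Shifting noises and policies -/

/-- The sequence `a, s 0, s 1, …`. -/
def consSeq {α : Type*} (a : α) (s : ℕ → α) : ℕ → α
  | 0 => a
  | n + 1 => s n

namespace MPCData

variable {d m q : ℕ} (P : MPCData d m q)

theorem ctrlNorm_sub_rev (u v : Vec m) : P.ctrlNorm (u - v) = P.ctrlNorm (v - u) := by
  have : Fact (1 ≤ P.p) := ⟨P.one_le_p⟩
  simp only [ctrlNorm, WithLp.ofLp_sub, WithLp.toLp_sub]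
  exact norm_sub_rev _ _

theorem zero_mem_ctrlNoise : (0 : Vec m) ∈ P.ctrlNoise := by
  have : Fact (1 ≤ P.p) := ⟨P.one_le_p⟩
  simp [ctrlNoise, ctrlNorm, P.ε_pos.le]

theorem zero_mem_distSet : (0 : Vec q) ∈ P.distSet :=
  interior_subset P.zero_mem_interior_distSet

theorem zero_mem_ctrlSet : (0 : Vec m) ∈ P.ctrlSet :=
  interior_subset P.zero_mem_interior_ctrlSet

variable {P}

theorem isNoise_zero : P.IsNoise (fun _ => 0) fun _ => 0 := fun _ =>
  ⟨P.zero_mem_distSet, P.zero_mem_ctrlNoise⟩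

theorem IsNoise.cons {w : ℕ → Vec q} {v : ℕ → Vec m} (h : P.IsNoise w v) {w₀ : Vec q}
    (hw₀ : w₀ ∈ P.distSet) {v₀ : Vec m} (hv₀ : v₀ ∈ P.ctrlNoise) :
    P.IsNoise (consSeq w₀ w) (consSeq v₀ v)
  | 0 => ⟨hw₀, hv₀⟩
  | t + 1 => h t

variable (P)

theorem predicted_congr {π π' : ℕ → Vec d → Vec m} (x : Vec d) (w : ℕ → Vec q) (v : ℕ → Vec m)
    {t : ℕ} (h : ∀ s < t, π s = π' s) : P.predicted π x w v t = P.predicted π' x w v t := by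
  induction t with
  | zero => rfl
  | succ t ih =>
    simp only [predicted]
    rw [ih fun s hs => h s (hs.trans t.lt_succ_self), h t t.lt_succ_self]

theorem predicted_cons_succ (π : ℕ → Vec d → Vec m) (x : Vec d) (w₀ : Vec q) (w : ℕ → Vec q)
    (v₀ : Vec m) (v : ℕ → Vec m) (t : ℕ) :
    P.predicted π x (consSeq w₀ w) (consSeq v₀ v) (t + 1) =
      P.predicted (fun s => π (s + 1)) (P.fbar x (π 0 x) w₀ v₀) w v t := by
  induction t with
  | zero => rfl
  | succ t ih =>
    rw [predicted, ih]
    rfl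

open Classical in
/-- The policy `π₁, …, π_{N-1}, μ_F`, with the terminal feedback extended by `0` outside the
terminal set. -/
noncomputable def shiftPolicy (μF : Vec d → Vec m) (π : ℕ → Vec d → Vec m) (t : ℕ) (x : Vec d) :
    Vec m :=
  if t + 1 < P.N then π (t + 1) x else if x ∈ P.terminalSet then μF x else 0

/-- The state after one step and the noise sequence that remains reproduce the original
predictions, as long as the shifted policy does not yet use the terminal feedback. -/
theorem predicted_shiftPolicy (μF : Vec d → Vec m) (π : ℕ → Vec d → Vec m) (x : Vec d)
    (w₀ : Vec q) (w : ℕ → Vec q) (v₀ : Vec m) (v : ℕ → Vec m) {t : ℕ} (ht : t < P.N) :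
    P.predicted (P.shiftPolicy μF π) (P.fbar x (π 0 x) w₀ v₀) w v t =
      P.predicted π x (consSeq w₀ w) (consSeq v₀ v) (t + 1) := by
  rw [predicted_cons_succ]
  refine P.predicted_congr _ _ _ fun s hs => funext fun y => ?_
  rw [shiftPolicy, if_pos (by omega)]

variable {P}

/-- What is assumed of the terminal feedback, for a fixed offset `b`. -/
structure IsTerminalFeedback (P : MPCData d m q) (μF : Vec d → Vec m) (b : ℝ) : Prop where
  measurable : Measurable fun x : P.terminalSet => μF x
  add_mem : ∀ x ∈ P.terminalSet, ∀ v ∈ P.ctrlNoise, μF x + v ∈ P.ctrlSet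
  fbar_mem : ∀ x ∈ P.terminalSet, ∀ w ∈ P.distSet, ∀ v ∈ P.ctrlNoise,
    P.fbar x (μF x) w v ∈ P.terminalSet
  cost_le : ∀ x ∈ P.terminalSet, ∀ w ∈ P.distSet, ∀ v ∈ P.ctrlNoise,
    (P.finalCost (P.fbar x (μF x) w v) : ℝ) - P.finalCost x ≤ -(P.cost x (μF x) : ℝ) + b

theorem IsPolicy.shiftPolicy {π : ℕ → Vec d → Vec m} (hπ : P.IsPolicy π) {μF : Vec d → Vec m}
    {b : ℝ} (hF : P.IsTerminalFeedback μF b) : P.IsPolicy (P.shiftPolicy μF π) := by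
  classical
  intro t _
  by_cases h : t + 1 < P.N
  · have : P.shiftPolicy μF π t = π (t + 1) := funext fun x => by rw [MPCData.shiftPolicy, if_pos h]
    rw [this]
    exact hπ _ h
  · have heq : P.shiftPolicy μF π t = fun x => if x ∈ P.terminalSet then μF x else 0 :=
      funext fun x => by rw [MPCData.shiftPolicy, if_neg h]
    rw [heq]
    refine ⟨?_, fun x _ => ?_⟩
    · have hT : MeasurableSet P.terminalSet := P.terminalSet_compact.isClosed.measurableSet
      have hmeas : Measurable fun x : Vec d => if x ∈ P.terminalSet then μF x else 0 := by
        refine measurable_of_restrict_of_restrict_compl hT ?_ ?_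
        · convert hF.measurable using 1
          exact funext fun x => if_pos x.2
        · convert (measurable_const : Measurable fun _ : (P.terminalSetᶜ : Set (Vec d)) =>
            (0 : Vec m)) using 1
          exact funext fun x => if_neg x.2
      exact hmeas.comp measurable_subtype_coe
    · dsimp only
      split_ifs with hx
      · simpa using hF.add_mem x hx 0 P.zero_mem_ctrlNoise
      · exact P.zero_mem_ctrlSet

/-- At the last step the shifted policy applies the terminal feedback, in a terminal state. -/
theorem shiftPolicy_last {μF : Vec d → Vec m} {π : ℕ → Vec d → Vec m} {t : ℕ}
    (ht : t + 1 = P.N) {x : Vec d} (hx : x ∈ P.terminalSet) : P.shiftPolicy μF π t x = μF x := by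
  rw [shiftPolicy, if_neg (by omega), if_pos hx]

theorem IsFeasible.shiftPolicy {x : Vec d} {π : ℕ → Vec d → Vec m} (hπ : P.IsFeasible x π)
    {μF : Vec d → Vec m} {b : ℝ} (hF : P.IsTerminalFeedback μF b)
    (hsub : P.terminalSet ⊆ P.stateSet) {w₀ : Vec q} (hw₀ : w₀ ∈ P.distSet) {v₀ : Vec m}
    (hv₀ : v₀ ∈ P.ctrlNoise) :
    P.IsFeasible (P.fbar x (π 0 x) w₀ v₀) (P.shiftPolicy μF π) := by
  refine ⟨hπ.1.shiftPolicy hF, fun w v hwv => ?_⟩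
  obtain ⟨hstep, hend⟩ := hπ.2 _ _ (hwv.cons hw₀ hv₀)
  obtain ⟨n, hn⟩ : ∃ n, n + 1 = P.N := ⟨P.N - 1, Nat.sub_add_cancel P.one_le_N⟩
  have hlast := P.predicted_shiftPolicy μF π x w₀ w v₀ v (t := n) (by omega)
  rw [hn] at hlast
  rw [← hlast] at hend
  refine ⟨fun t ht => ?_, ?_⟩
  · rcases Nat.lt_or_ge (t + 1) P.N with h | h
    · obtain ⟨h1, h2⟩ := hstep _ h
      rw [P.predicted_shiftPolicy μF π x w₀ w v₀ v ht, MPCData.shiftPolicy, if_pos h]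
      exact ⟨h1, h2⟩
    · obtain rfl : t = n := by omega
      rw [shiftPolicy_last hn hend]
      exact ⟨hsub hend, hF.add_mem _ hend _ (hwv t).2⟩
  · rw [← hn, predicted, shiftPolicy_last hn hend]
    exact hF.fbar_mem _ hend _ (hwv n).1 _ (hwv n).2

/-! ### Costs along shifted policies -/

/-- Shifting drops the first stage cost and adds one stage under the terminal feedback, which by the
terminal inequality costs at most `b`. -/
theorem totalCost_shiftPolicy_le {x : Vec d} {π : ℕ → Vec d → Vec m} (hπ : P.IsFeasible x π)
    {μF : Vec d → Vec m} {b : ℝ≥0} (hF : P.IsTerminalFeedback μF b) {w₀ : Vec q}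
    (hw₀ : w₀ ∈ P.distSet) {v₀ : Vec m} (hv₀ : v₀ ∈ P.ctrlNoise) {w : ℕ → Vec q}
    {v : ℕ → Vec m} (hwv : P.IsNoise w v) :
    P.totalCost (P.fbar x (π 0 x) w₀ v₀) (P.shiftPolicy μF π) w v + P.cost x (π 0 x) ≤
      P.totalCost x π (consSeq w₀ w) (consSeq v₀ v) + b := by
  have hend := (hπ.2 _ _ (hwv.cons hw₀ hv₀)).2
  obtain ⟨n, hn⟩ : ∃ n, n + 1 = P.N := ⟨P.N - 1, Nat.sub_add_cancel P.one_le_N⟩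
  have hlast := P.predicted_shiftPolicy μF π x w₀ w v₀ v (t := n) (by omega)
  rw [hn] at hlast
  have hend' := hend
  rw [← hlast] at hend'
  have hsum : ∑ t ∈ Finset.range n,
      P.cost (P.predicted (P.shiftPolicy μF π) (P.fbar x (π 0 x) w₀ v₀) w v t)
        (P.shiftPolicy μF π t
          (P.predicted (P.shiftPolicy μF π) (P.fbar x (π 0 x) w₀ v₀) w v t)) =
      ∑ t ∈ Finset.range n, P.cost (P.predicted π x (consSeq w₀ w) (consSeq v₀ v) (t + 1))
        (π (t + 1) (P.predicted π x (consSeq w₀ w) (consSeq v₀ v) (t + 1))) := by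
    refine Finset.sum_congr rfl fun t ht => ?_
    have ht' := Finset.mem_range.1 ht
    rw [P.predicted_shiftPolicy μF π x w₀ w v₀ v (by omega), shiftPolicy, if_pos (by omega)]
  have hsucc : P.predicted (P.shiftPolicy μF π) (P.fbar x (π 0 x) w₀ v₀) w v (n + 1) =
      P.fbar (P.predicted (P.shiftPolicy μF π) (P.fbar x (π 0 x) w₀ v₀) w v n)
        (μF (P.predicted (P.shiftPolicy μF π) (P.fbar x (π 0 x) w₀ v₀) w v n)) (w n) (v n) := by
    rw [predicted, shiftPolicy_last hn hend']
  have hcost := hF.cost_le _ hend' _ (hwv n).1 _ (hwv n).2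
  rw [totalCost, totalCost, ← hn, Finset.sum_range_succ, Finset.sum_range_succ', hsum, hn,
    ← hlast, ← hn, shiftPolicy_last hn hend', hsucc, predicted.eq_1 P π]
  rw [← NNReal.coe_le_coe]
  simp only [NNReal.coe_add]
  linarith

theorem totalCost_le_worstCost (x : Vec d) (π : ℕ → Vec d → Vec m) {w : ℕ → Vec q}
    {v : ℕ → Vec m} (hwv : P.IsNoise w v) :
    (P.totalCost x π w v : ℝ≥0∞) ≤ P.worstCost x π :=
  le_iSup₂_of_le w v (le_iSup_of_le hwv le_rfl)

theorem cost_le_worstCost (x : Vec d) (π : ℕ → Vec d → Vec m) :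
    (P.cost x (π 0 x) : ℝ≥0∞) ≤ P.worstCost x π := by
  refine le_trans ?_ (totalCost_le_worstCost x π isNoise_zero)
  refine ENNReal.coe_le_coe.2 (le_add_right ?_)
  exact Finset.single_le_sum (f := fun t => P.cost (P.predicted π x (fun _ => 0) (fun _ => 0) t)
    (π t (P.predicted π x (fun _ => 0) (fun _ => 0) t))) (fun _ _ => zero_le)
    (Finset.mem_range.2 P.one_le_N)

theorem worstCost_shiftPolicy_add_cost_le {x : Vec d} {π : ℕ → Vec d → Vec m}
    (hπ : P.IsFeasible x π) {μF : Vec d → Vec m} {b : ℝ≥0} (hF : P.IsTerminalFeedback μF b)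
    {w₀ : Vec q} (hw₀ : w₀ ∈ P.distSet) {v₀ : Vec m} (hv₀ : v₀ ∈ P.ctrlNoise) :
    P.worstCost (P.fbar x (π 0 x) w₀ v₀) (P.shiftPolicy μF π) + P.cost x (π 0 x) ≤
      P.worstCost x π + b := by
  have h1 : P.worstCost (P.fbar x (π 0 x) w₀ v₀) (P.shiftPolicy μF π) ≤
      P.worstCost x π + b - P.cost x (π 0 x) := by
    refine iSup_le fun w => iSup_le fun v => iSup_le fun hwv => ?_
    refine ENNReal.le_sub_of_add_le_right ENNReal.coe_ne_top ?_
    calc (P.totalCost (P.fbar x (π 0 x) w₀ v₀) (P.shiftPolicy μF π) w v : ℝ≥0∞) +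
          P.cost x (π 0 x)
        ≤ P.totalCost x π (consSeq w₀ w) (consSeq v₀ v) + b := by
          exact_mod_cast totalCost_shiftPolicy_le hπ hF hw₀ hv₀ hwv
      _ ≤ P.worstCost x π + b := by
          gcongr
          exact totalCost_le_worstCost x π (hwv.cons hw₀ hv₀)
  calc _ ≤ P.worstCost x π + b - P.cost x (π 0 x) + P.cost x (π 0 x) := by gcongr
    _ = P.worstCost x π + b := tsub_add_cancel_of_le (le_add_right (cost_le_worstCost x π))

/-! ### The value function -/

variable (P) in
/-- The optimal value of the min-max problem with initial state `x` (infinite where the problem is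
infeasible). -/
noncomputable def valueFn (x : Vec d) : ℝ≥0∞ :=
  ⨅ (π : ℕ → Vec d → Vec m) (_ : P.IsFeasible x π), P.worstCost x π

theorem valueFn_le {x : Vec d} {π : ℕ → Vec d → Vec m} (hπ : P.IsFeasible x π) :
    P.valueFn x ≤ P.worstCost x π := iInf₂_le π hπ

theorem IsSolution.worstCost_eq {x : Vec d} {π : ℕ → Vec d → Vec m} (hπ : P.IsSolution x π) :
    P.worstCost x π = P.valueFn x :=
  le_antisymm (le_iInf₂ hπ.2) (valueFn_le hπ.1)

theorem HasUniqueSolutions.exists_optFeedback_eq (hsol : P.HasUniqueSolutions) {x : Vec d}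
    (hx : x ∈ P.feasibleSet) : ∃ π, P.IsSolution x π ∧ P.optFeedback x = π 0 x := by
  have h := (hsol.2 x hx).1
  exact ⟨h.choose, h.choose_spec, by rw [optFeedback, dif_pos h]⟩

theorem feasibleSet_subset_stateSet : P.feasibleSet ⊆ P.stateSet := fun _ ⟨_, hπ⟩ =>
  ((hπ.2 _ _ isNoise_zero).1 0 P.one_le_N).1

theorem IsFeasible.add_mem_ctrlSet {x : Vec d} {π : ℕ → Vec d → Vec m} (hπ : P.IsFeasible x π)
    {v : Vec m} (hv : v ∈ P.ctrlNoise) : π 0 x + v ∈ P.ctrlSet :=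
  ((hπ.2 (fun _ => 0) (fun _ => v) fun _ => ⟨P.zero_mem_distSet, hv⟩).1 0 P.one_le_N).2

theorem le_valueFn {α : ℝ≥0 → ℝ≥0}
    (hα : ∀ x ∈ P.feasibleSet, ∀ u ∈ P.ctrlSet, α ‖x‖₊ ≤ P.cost x u) (x : Vec d) :
    (α ‖x‖₊ : ℝ≥0∞) ≤ P.valueFn x := by
  refine le_iInf₂ fun π hπ => le_trans ?_ (cost_le_worstCost x π)
  have hu : π 0 x ∈ P.ctrlSet := by simpa using hπ.add_mem_ctrlSet P.zero_mem_ctrlNoise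
  exact_mod_cast hα x ⟨π, hπ⟩ _ hu

/-- The states that feasible predictions reach in `t ≤ N` steps from a bounded set are bounded,
uniformly in the policy and the noise. -/
theorem exists_predicted_le (r : ℝ≥0) {t : ℕ} (ht : t ≤ P.N) :
    ∃ R : ℝ≥0, ∀ x : Vec d, ‖x‖₊ ≤ r → ∀ π, P.IsFeasible x π → ∀ w v, P.IsNoise w v →
      ‖P.predicted π x w v t‖₊ ≤ R := by
  induction t with
  | zero => exact ⟨r, fun x hx _ _ _ _ _ => hx⟩
  | succ t ih =>
    obtain ⟨R, hR⟩ := ih (by omega)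
    have hK : IsCompact (Metric.closedBall (0 : Vec d) R ×ˢ P.ctrlSet ×ˢ P.distSet) :=
      (isCompact_closedBall _ _).prod (P.ctrlSet_compact.prod P.distSet_compact)
    obtain ⟨C, hC⟩ := (hK.image P.f_cont).isBounded.exists_norm_le
    refine ⟨C.toNNReal, fun x hx π hπ w v hwv => NNReal.le_toNNReal_of_coe_le ?_⟩
    refine hC _ ⟨(P.predicted π x w v t, π t (P.predicted π x w v t) + v t, w t), ⟨?_, ?_, ?_⟩, rfl⟩
    · rw [mem_closedBall_zero_iff]
      exact_mod_cast hR x hx π hπ w v hwv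
    · exact ((hπ.2 w v hwv).1 t ht).2
    · exact (hwv t).1

theorem exists_worstCost_le (hbd : P.CostBoundedOnBounded) {α : ℝ≥0 → ℝ≥0} (hα : Monotone α)
    (hfin : ∀ x ∈ P.terminalSet, P.finalCost x ≤ α ‖x‖₊) (r : ℝ≥0) :
    ∃ C : ℝ≥0, ∀ x : Vec d, ‖x‖₊ ≤ r → ∀ π, P.IsFeasible x π → P.worstCost x π ≤ C := by
  have hstage : ∀ t, ∃ C : ℝ≥0, t < P.N → ∀ x : Vec d, ‖x‖₊ ≤ r → ∀ π, P.IsFeasible x π →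
      ∀ w v, P.IsNoise w v →
        P.cost (P.predicted π x w v t) (π t (P.predicted π x w v t)) ≤ C := by
    intro t
    by_cases ht : t < P.N
    · obtain ⟨R, hR⟩ := P.exists_predicted_le r ht.le
      obtain ⟨C, hC⟩ := hbd R
      refine ⟨C, fun _ x hx π hπ w v hwv => ?_⟩
      have hmem := ((hπ.2 w v hwv).1 t ht).1
      exact hC _ hmem (hR x hx π hπ w v hwv) _ ((hπ.1 t ht).2 _ hmem)
    · exact ⟨0, fun h => absurd h ht⟩
  choose C hC using hstage
  obtain ⟨R, hR⟩ := P.exists_predicted_le r le_rfl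
  refine ⟨∑ t ∈ Finset.range P.N, C t + α R, fun x hx π hπ =>
    iSup_le fun w => iSup_le fun v => iSup_le fun hwv => ENNReal.coe_le_coe.2 ?_⟩
  refine add_le_add (Finset.sum_le_sum fun t ht =>
    hC t (Finset.mem_range.1 ht) x hx π hπ w v hwv) ?_
  exact (hfin _ (hπ.2 w v hwv).2).trans (hα (hR x hx π hπ w v hwv))

/-- If the stage cost is bounded on bounded sets, the value function is bounded by a monotone
function of the norm. -/
theorem exists_monotone_valueFn_le (hbd : P.CostBoundedOnBounded) {α : ℝ≥0 → ℝ≥0}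
    (hα : Monotone α) (hfin : ∀ x ∈ P.terminalSet, P.finalCost x ≤ α ‖x‖₊) :
    ∃ γ : ℝ≥0 → ℝ≥0, Monotone γ ∧ ∀ x ∈ P.feasibleSet, P.valueFn x ≤ γ ‖x‖₊ := by
  choose C hC using fun r => exists_worstCost_le hbd hα hfin r
  refine ⟨fun s => (Finset.range (⌈s⌉₊ + 1)).sup fun n => C n, fun a b hab =>
    Finset.sup_mono (Finset.range_mono (by gcongr)), fun x ⟨π, hπ⟩ => ?_⟩
  refine (valueFn_le hπ).trans ((hC ⌈‖x‖₊⌉₊ x (Nat.le_ceil _) π hπ).trans ?_)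
  exact ENNReal.coe_le_coe.2 (Finset.le_sup (f := fun n : ℕ => C n)
    (Finset.mem_range.2 (Nat.lt_succ_self _)))

/-! ### The closed loop with an approximate feedback -/

/-- A feedback within the error margin acts like the optimal feedback with an admissible noise. -/
theorem exists_solution_closedLoop_eq (hsol : P.HasUniqueSolutions) {μ : Vec d → Vec m}
    {x : Vec d} (hx : x ∈ P.feasibleSet) (hμ : P.ctrlNorm (P.optFeedback x - μ x) ≤ P.ε) :
    ∃ π, P.IsSolution x π ∧ ∃ v ∈ P.ctrlNoise, μ x = π 0 x + v ∧
      ∀ w, P.closedLoop μ x w = P.fbar x (π 0 x) w v := by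
  obtain ⟨π, hπ, hopt⟩ := hsol.exists_optFeedback_eq hx
  have h : μ x = π 0 x + (μ x - π 0 x) := (add_sub_cancel _ _).symm
  refine ⟨π, hπ, μ x - π 0 x, ?_, h, fun w => ?_⟩
  · rw [hopt, ctrlNorm_sub_rev] at hμ
    exact hμ
  · rw [closedLoop, fbar, ← h]

theorem isRPI_closedLoop (hsol : P.HasUniqueSolutions) {μF : Vec d → Vec m} {b : ℝ}
    (hF : P.IsTerminalFeedback μF b) (hsub : P.terminalSet ⊆ P.stateSet) {μ : Vec d → Vec m}
    (hμ : ∀ x ∈ P.feasibleSet, P.ctrlNorm (P.optFeedback x - μ x) ≤ P.ε) :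
    IsRPI (P.closedLoop μ) P.distSet P.feasibleSet := by
  intro x hx w hw
  obtain ⟨π, hπ, v, hv, -, heq⟩ := exists_solution_closedLoop_eq hsol hx (hμ x hx)
  rw [heq]
  exact ⟨_, hπ.1.shiftPolicy hF hsub hw hv⟩

theorem valueFn_closedLoop_add_cost_le (hsol : P.HasUniqueSolutions) {μF : Vec d → Vec m}
    {b : ℝ≥0} (hF : P.IsTerminalFeedback μF b) (hsub : P.terminalSet ⊆ P.stateSet)
    {μ : Vec d → Vec m} {x : Vec d} (hx : x ∈ P.feasibleSet)
    (hμ : P.ctrlNorm (P.optFeedback x - μ x) ≤ P.ε) {w : Vec q} (hw : w ∈ P.distSet) :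
    ∃ u ∈ P.ctrlSet, P.valueFn (P.closedLoop μ x w) + P.cost x u ≤ P.valueFn x + b := by
  obtain ⟨π, hπ, v, hv, -, heq⟩ := exists_solution_closedLoop_eq hsol hx hμ
  refine ⟨π 0 x, by simpa using hπ.1.add_mem_ctrlSet P.zero_mem_ctrlNoise, ?_⟩
  rw [heq, ← hπ.worstCost_eq]
  exact (add_le_add_left (valueFn_le (hπ.1.shiftPolicy hF hsub hw hv)) _).trans
    (worstCost_shiftPolicy_add_cost_le hπ.1 hF hw hv)

end MPCData

theorem IsRPI.trajectory_mem {d q : ℕ} {g : Vec d → Vec q → Vec d} {W : Set (Vec q)}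
    {X : Set (Vec d)} (h : IsRPI g W X) {x₀ : Vec d} (hx₀ : x₀ ∈ X) {w : ℕ → Vec q}
    (hw : ∀ k, w k ∈ W) (t : ℕ) : trajectory g x₀ w t ∈ X := by
  induction t with
  | zero => exact hx₀
  | succ t ih => exact h _ ih _ (hw t)

/-- On a bounded invariant set the practical estimate holds with the radius of the set as offset. -/
theorem IsRPI.practicalISSEstimate_of_isBounded {d q : ℕ} {g : Vec d → Vec q → Vec d}
    {W : Set (Vec q)} {X : Set (Vec d)} (h : IsRPI g W X) (hX : Bornology.IsBounded X) :
    PracticalISSEstimate g W X := by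
  obtain ⟨C, hC⟩ := hX.exists_norm_le
  refine ⟨_, id, C.toNNReal + 1, isClassKL_decay isClassK_id (OrderIso.refl _), isClassK_id,
    by positivity, fun x₀ hx₀ w hw t => le_add_left (le_add_right ?_)⟩
  exact NNReal.le_toNNReal_of_coe_le (hC _ (h.trajectory_mem hx₀ hw t))

namespace MPCData

variable {d m q : ℕ} {P : MPCData d m q}

theorem practicalISSEstimate_closedLoop (hsol : P.HasUniqueSolutions) {μF : Vec d → Vec m}
    {b : ℝ≥0} (hF : P.IsTerminalFeedback μF b) (hsub : P.terminalSet ⊆ P.stateSet)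
    {α₁ α₂ : ℝ≥0 → ℝ≥0} (hα₁ : IsClassKInf α₁) (hα₂ : Monotone α₂)
    (hcost : ∀ x ∈ P.feasibleSet, ∀ u ∈ P.ctrlSet, α₁ ‖x‖₊ ≤ P.cost x u)
    (hfin : ∀ x ∈ P.terminalSet, P.finalCost x ≤ α₂ ‖x‖₊) (hbd : P.CostBoundedOnBounded)
    {μ : Vec d → Vec m} (hμ : ∀ x ∈ P.feasibleSet, P.ctrlNorm (P.optFeedback x - μ x) ≤ P.ε) :
    PracticalISSEstimate (P.closedLoop μ) P.distSet P.feasibleSet := by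
  obtain ⟨γ, hγ, hVγ⟩ := exists_monotone_valueFn_le hbd hα₂ hfin
  obtain ⟨β, φ, hβ, hφ, hbound⟩ := exists_classKL_bound_of_decrease hα₁ hγ b
  refine ⟨β, id, φ, hβ, isClassK_id, hφ, fun x₀ hx₀ w hw t => ?_⟩
  have hmem := (isRPI_closedLoop hsol hF hsub hμ).trajectory_mem hx₀ hw
  -- the value is finite along the trajectory, so it may be read as a real number
  have hV : ∀ t, ((P.valueFn (trajectory (P.closedLoop μ) x₀ w t)).toNNReal : ℝ≥0∞) =
      P.valueFn (trajectory (P.closedLoop μ) x₀ w t) := fun t =>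
    ENNReal.coe_toNNReal ((hVγ _ (hmem t)).trans_lt ENNReal.coe_lt_top).ne
  refine (hbound (fun t => (P.valueFn (trajectory (P.closedLoop μ) x₀ w t)).toNNReal)
    (fun t => ‖trajectory (P.closedLoop μ) x₀ w t‖₊) (fun t => ?_) (fun t => ?_) (fun t => ?_)
    t).trans (add_le_add_left (le_max_left _ _) _)
  · rw [← ENNReal.coe_le_coe, hV]
    exact le_valueFn hcost _
  · rw [← ENNReal.coe_le_coe, hV]
    exact hVγ _ (hmem t)
  · rw [← ENNReal.coe_le_coe, ENNReal.coe_add, ENNReal.coe_add, hV, hV]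
    obtain ⟨u, hu, hle⟩ :=
      valueFn_closedLoop_add_cost_le hsol hF hsub (hmem t) (hμ _ (hmem t)) (hw t)
    exact (add_le_add_right (ENNReal.coe_le_coe.2 (hcost _ (hmem t) u hu)) _).trans hle

end MPCData

theorem theorem4p2 {d m q : ℕ} (P : MPCData d m q)
    (hsol : P.HasUniqueSolutions)
    (L₀ : ℝ≥0) (hLip : LipschitzOnWith L₀ P.optFeedback P.feasibleSet)
    (hstab : P.StabilityAssumption)
    (ψ : 𝓢(Vec d, ℝ)) (h D ρ : ℝ) (hh : 0 < h) (hD : 0 < D) (hρ : 0 < ρ)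
    (hε : ∀ x ∈ P.feasibleSet,
      P.ctrlNorm (P.optFeedback x - P.approxFeedback L₀ ψ h D ρ x) ≤ P.ε) :
    P.RecursivelyFeasible (P.approxFeedback L₀ ψ h D ρ) ∧
    IsRPI (P.closedLoop (P.approxFeedback L₀ ψ h D ρ)) P.distSet P.feasibleSet ∧
    (IsCompact P.feasibleSet →
      IsRegionalPracticalISS (P.closedLoop (P.approxFeedback L₀ ψ h D ρ)) P.distSet
        P.feasibleSet) ∧
    (P.CostBoundedOnBounded →
      PracticalISSEstimate (P.closedLoop (P.approxFeedback L₀ ψ h D ρ)) P.distSet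
        P.feasibleSet) := by
  obtain ⟨⟨μF, b, hb, hmeas, hF⟩, hsub, α₁, α₂, hα₁, hα₂, hcost, hfin⟩ := hstab
  lift b to ℝ≥0 using hb.le
  have hF' : P.IsTerminalFeedback μF b :=
    ⟨hmeas, fun x hx v hv => (hF x hx 0 P.zero_mem_distSet v hv).1,
      fun x hx w hw v hv => (hF x hx w hw v hv).2.1,
      fun x hx w hw v hv => (hF x hx w hw v hv).2.2⟩
  have hrpi := MPCData.isRPI_closedLoop hsol hF' hsub hε
  refine ⟨fun x₀ hx₀ w hw t => ?_, hrpi, fun hcomp =>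
    ⟨hcomp, hrpi, hrpi.practicalISSEstimate_of_isBounded hcomp.isBounded⟩, fun hbd =>
    MPCData.practicalISSEstimate_closedLoop hsol hF' hsub hα₁ hα₂.1.2.1.monotone hcost hfin hbd
      hε⟩
  have hmem := hrpi.trajectory_mem hx₀ hw t
  refine ⟨hmem, MPCData.feasibleSet_subset_stateSet hmem, ?_⟩
  obtain ⟨π, hπ, v, hv, heq, -⟩ := MPCData.exists_solution_closedLoop_eq hsol hmem (hε _ hmem)
  rw [heq]
  exact hπ.1.add_mem_ctrlSet hv
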